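/- A convex disk is a compact convex subset of $\mathbb{R}^2$ with non-empty interior, and $|S|$ denotes the area of $S$. Let $B_r$ be the disk of radius $r$ centered at the origin. The density of a covering $\mathcal F=\{K_i\}$ of $\mathbb{R}^2$ by congruent copies of a convex disk $K$ is $$d(\mathcal F)=\liminf_{r\to\infty}\frac{1}{|B_r|}\sum_i |K_i\cap B_r| .$$ Let $\vartheta(K)$ be the infimum of $d(\mathcal F)$ over all coverings $\mathcal F$ of $\mathbb{R}^2$ by congruent copies of $K$, let $\vartheta_T(K)$ be the infimum over coverings by translates of $K$ only, and let $\vartheta_L(K)$ be the infimum over coverings $\{K+v : v\in L\}$ with $L$ a full-rank lattice in $\mathbb{R}^2$. **Proposition 5.** Let $C$ be a circular disk (of positive radius) and let $h$ be a regular hexagon inscribed in $C$. If $K$ is a convex disk sandwiched between $C$ and $h$, that is, $h\subseteq K\subseteq C$ or $C\subseteq K\subseteq h$ (the latter cannot occur), then $$\vartheta(K)=\frac{|K|}{|h|}\qquad\text{and}\qquad \vartheta(K)=\vartheta_T(K)=\vartheta_L(K).$$ -/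

import Mathlib

open MeasureTheory Filter

noncomputable section

namespace CoveringDensity

/-- A convex body in `ℝⁿ`: a compact convex set with an interior point. -/
structure IsConvexBody {n : ℕ} (K : Set (EuclideanSpace ℝ (Fin n))) : Prop where
  isCompact : IsCompact K
  convex : Convex ℝ K
  nonempty_interior : (interior K).Nonempty

/-- A convex disk is a two-dimensional convex body. -/
abbrev IsConvexDisk (K : Set (EuclideanSpace ℝ (Fin 2))) : Prop := IsConvexBody K

/-- `S` is congruent to `K`: it is the image of `K` under an isometry of the whole space
(reflections are allowed). -/
def IsCongruentTo {n : ℕ} (S K : Set (EuclideanSpace ℝ (Fin n))) : Prop :=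
  ∃ φ : EuclideanSpace ℝ (Fin n) ≃ᵢ EuclideanSpace ℝ (Fin n), S = φ '' K

/-- `S` is a translate of `K`. -/
def IsTranslateOf {n : ℕ} (S K : Set (EuclideanSpace ℝ (Fin n))) : Prop :=
  ∃ v : EuclideanSpace ℝ (Fin n), S = (fun x => x + v) '' K

/-- A family of sets is a covering if its union is the whole space. -/
def IsCovering {n : ℕ} {ι : Type} (F : ι → Set (EuclideanSpace ℝ (Fin n))) : Prop :=
  (⋃ i, F i) = Set.univ

/-- `|F ∩ D|`: the sum of the volumes of the sets `F i ∩ D` over all members of the family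
(possibly infinite). -/
def volumeIn {n : ℕ} {ι : Type} (F : ι → Set (EuclideanSpace ℝ (Fin n)))
    (D : Set (EuclideanSpace ℝ (Fin n))) : ENNReal :=
  ∑' i, volume (F i ∩ D)

/-- The density of a covering: the lower limit, as `r → ∞`, of `|F ∩ B_r| / |B_r|`, where `B_r` is
the ball of radius `r` about the origin.  It is the limit whenever the limit exists. -/
def coveringFamilyDensity {n : ℕ} {ι : Type} (F : ι → Set (EuclideanSpace ℝ (Fin n))) : ENNReal :=
  liminf (fun r : ℝ =>
    volumeIn F (Metric.closedBall 0 r) /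
      volume (Metric.closedBall (0 : EuclideanSpace ℝ (Fin n)) r)) atTop

/-- The covering density `ϑ(K)`: the infimum of the densities of all coverings of the space by
congruent copies of `K`. -/
def coveringDensity {n : ℕ} (K : Set (EuclideanSpace ℝ (Fin n))) : ENNReal :=
  sInf {d | ∃ (ι : Type) (F : ι → Set (EuclideanSpace ℝ (Fin n))),
    (∀ i, IsCongruentTo (F i) K) ∧ IsCovering F ∧ d = coveringFamilyDensity F}

/-- The translative covering density `ϑ_T(K)`: only translates of `K` are used. -/
def translativeCoveringDensity {n : ℕ} (K : Set (EuclideanSpace ℝ (Fin n))) : ENNReal :=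
  sInf {d | ∃ (ι : Type) (F : ι → Set (EuclideanSpace ℝ (Fin n))),
    (∀ i, IsTranslateOf (F i) K) ∧ IsCovering F ∧ d = coveringFamilyDensity F}

/-- The lattice arrangement of `K` belonging to `L`: all translates of `K` by vectors of `L`. -/
def latticeArrangement {n : ℕ} (L : Submodule ℤ (EuclideanSpace ℝ (Fin n)))
    (K : Set (EuclideanSpace ℝ (Fin n))) : L → Set (EuclideanSpace ℝ (Fin n)) :=
  fun v => (fun x => x + (v : EuclideanSpace ℝ (Fin n))) '' K

/-- The lattice covering density `ϑ_L(K)`: only arrangements of translates of `K` by the vectors of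
a full-rank lattice are used. -/
def latticeCoveringDensity {n : ℕ} (K : Set (EuclideanSpace ℝ (Fin n))) : ENNReal :=
  sInf {d | ∃ (L : Submodule ℤ (EuclideanSpace ℝ (Fin n))) (_ : DiscreteTopology L),
    IsZLattice ℝ L ∧ IsCovering (latticeArrangement L K) ∧
      d = coveringFamilyDensity (latticeArrangement L K)}

/-- `B` is sandwiched between `A` and `C`. -/
def IsSandwiched {n : ℕ} (B A C : Set (EuclideanSpace ℝ (Fin n))) : Prop :=
  (A ⊆ B ∧ B ⊆ C) ∨ (C ⊆ B ∧ B ⊆ A)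

/-- The regular hexagon inscribed in the circle of centre `c` and radius `r`, with one vertex in the
direction `θ`. -/
def regularHexagon (c : EuclideanSpace ℝ (Fin 2)) (r θ : ℝ) : Set (EuclideanSpace ℝ (Fin 2)) :=
  convexHull ℝ (Set.range fun k : Fin 6 =>
    c + r • !₂[Real.cos (θ + (k : ℕ) * (Real.pi / 3)), Real.sin (θ + (k : ℕ) * (Real.pi / 3))])

end CoveringDensity

end

namespace CoveringDensity

/-! Let `h` be the hexagon and `C` the disk. The disk cannot lie in the hexagon, so `h ⊆ K ⊆ C`, and
two bounds meet at `|K| / |h|`.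

Upper bound: translates of `h` by a lattice of covolume `|h|` cover the plane
(`exists_basis_covering`). Enlarging `h` to `K` keeps the covering, and the density becomes at most
`|K| / |h|` (`coveringFamilyDensity_latticeArrangement_le`).

Lower bound: in a covering by congruent copies of `K`, the circumscribed disks of radius `r` also
cover, so it suffices to count their centres. This is Kershner's theorem
(`volume_closedBall_le_card_mul`). Triangulate the centres by a Delaunay subdivision. Away from the
boundary, a circumdisk contains essentially no centre in its interior, so its radius is essentially
at most `r`, and each triangle has area at most that of the equilateral triangle inscribed in such a
disk, namely `|h| / 2`. There are at most twice as many triangles as centres, so each centre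
accounts for area at most `|h|`.

The subdivision is the lower convex hull of the points lifted to heights close to `‖p‖ ^ 2`. A
generic perturbation of size `δ` makes its cells triangles, and `δ` finally tends to `0`.

Since `ϑ ≤ ϑ_T ≤ ϑ_L`, the two bounds force equality throughout. -/

/-- The Euclidean plane. -/
abbrev Plane : Type := EuclideanSpace ℝ (Fin 2)

/-! ### Areas in affine coordinates -/

/-- The cross product of two plane vectors. -/
def cross (a b : Plane) : ℝ := a 0 * b 1 - a 1 * b 0

lemma det_toLin_basisFun (M : Matrix (Fin 2) (Fin 2) ℝ) :
    LinearMap.det (Matrix.toLin (EuclideanSpace.basisFun (Fin 2) ℝ).toBasis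
      (EuclideanSpace.basisFun (Fin 2) ℝ).toBasis M) = M.det :=
  LinearMap.det_toLin _ _

lemma volume_image_coords (S : Set (ℝ × ℝ)) :
    volume ((fun z : ℝ × ℝ => (!₂[z.1, z.2] : Plane)) '' S) = volume S := by
  have h1 := EuclideanSpace.volume_preserving_symm_measurableEquiv_toLp (Fin 2)
  have h2 := volume_preserving_finTwoArrow ℝ
  have h3 : (fun z : ℝ × ℝ => (!₂[z.1, z.2] : Plane)) '' S =
      (MeasurableEquiv.toLp 2 (Fin 2 → ℝ)).symm ⁻¹' (MeasurableEquiv.finTwoArrow ⁻¹' S) := by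
    ext x
    simp only [Set.mem_image, Set.mem_preimage]
    constructor
    · rintro ⟨z, hz, rfl⟩
      exact hz
    · intro h
      refine ⟨_, h, ?_⟩
      ext i
      fin_cases i <;> rfl
  rw [h3, h1.measure_preimage_equiv, h2.measure_preimage_equiv]

/-- Area of a region described in affine coordinates. -/
lemma volume_image_affine (c a b : Plane) (S : Set (ℝ × ℝ)) :
    volume ((fun z : ℝ × ℝ => c + (z.1 • a + z.2 • b)) '' S)
      = ENNReal.ofReal |cross a b| * volume S := by
  set A := Matrix.toLin (EuclideanSpace.basisFun (Fin 2) ℝ).toBasis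
      (EuclideanSpace.basisFun (Fin 2) ℝ).toBasis !![a 0, b 0; a 1, b 1] with hA
  have key : (fun z : ℝ × ℝ => c + (z.1 • a + z.2 • b)) '' S =
      (fun x => c + x) '' (A '' ((fun z : ℝ × ℝ => (!₂[z.1, z.2] : Plane)) '' S)) := by
    rw [Set.image_image, Set.image_image]
    refine Set.image_congr fun z _ => ?_
    congr 1
    rw [hA, Matrix.toLin_apply]
    ext i
    fin_cases i <;> simp [Matrix.mulVec, dotProduct] <;> ring
  rw [key, Set.image_add_left, measure_preimage_add, Measure.addHaar_image_linearMap,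
    volume_image_coords, hA, det_toLin_basisFun, Matrix.det_fin_two_of, cross]
  congr 3
  ring

/-- Area of the region between two graphs, boundary included. -/
lemma volume_between_graphs {p q : ℝ} (hpq : p ≤ q) {f g : ℝ → ℝ} (hf : Continuous f)
    (hg : Continuous g) (hfg : ∀ s ∈ Set.Icc p q, f s ≤ g s) :
    volume {z : ℝ × ℝ | z.1 ∈ Set.Icc p q ∧ z.2 ∈ Set.Icc (f z.1) (g z.1)}
      = ENNReal.ofReal (∫ s in p..q, (g s - f s)) := by
  have hm : MeasurableSet {z : ℝ × ℝ | z.1 ∈ Set.Icc p q ∧ z.2 ∈ Set.Icc (f z.1) (g z.1)} := by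
    apply IsClosed.measurableSet
    apply IsClosed.inter
    · exact isClosed_Icc.preimage continuous_fst
    · exact (isClosed_le (hf.comp continuous_fst) continuous_snd).inter
        (isClosed_le continuous_snd (hg.comp continuous_fst))
  rw [Measure.volume_eq_prod, Measure.prod_apply hm]
  have h1 : ∀ s : ℝ, volume (Prod.mk s ⁻¹' {z : ℝ × ℝ | z.1 ∈ Set.Icc p q ∧
      z.2 ∈ Set.Icc (f z.1) (g z.1)}) =
      (Set.Icc p q).indicator (fun s => ENNReal.ofReal (g s - f s)) s := by
    intro s
    by_cases hs : s ∈ Set.Icc p q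
    · rw [Set.indicator_of_mem hs, ← Real.volume_Icc]
      congr 1
      ext t
      simp [hs.1, hs.2]
    · rw [Set.indicator_of_notMem hs]
      have : Prod.mk s ⁻¹' {z : ℝ × ℝ | z.1 ∈ Set.Icc p q ∧ z.2 ∈ Set.Icc (f z.1) (g z.1)} = ∅ := by
        ext t
        simp only [Set.mem_preimage, Set.mem_ofPred_eq, Set.mem_empty_iff_false, iff_false]
        exact fun h => hs h.1
      rw [this, measure_empty]
  simp_rw [h1]
  rw [lintegral_indicator measurableSet_Icc, intervalIntegral.integral_of_le hpq,
    ← integral_Icc_eq_integral_Ioc, ofReal_integral_eq_lintegral_ofReal]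
  · exact ((hg.sub hf).continuousOn).integrableOn_compact isCompact_Icc
  · exact (ae_restrict_mem measurableSet_Icc).mono fun s hs => sub_nonneg.2 (hfg s hs)

lemma volume_standard_triangle :
    volume {z : ℝ × ℝ | 0 ≤ z.1 ∧ 0 ≤ z.2 ∧ z.1 + z.2 ≤ 1} = ENNReal.ofReal (1 / 2) := by
  have := volume_between_graphs (p := 0) (q := 1) zero_le_one (f := fun _ => 0)
    (g := fun s => 1 - s) (by fun_prop) (by fun_prop) (fun s hs => by linarith [hs.2])
  convert this using 2
  · ext z
    simp only [Set.mem_ofPred_eq, Set.mem_Icc]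
    constructor
    · rintro ⟨h1, h2, h3⟩
      exact ⟨⟨h1, by linarith⟩, h2, by linarith⟩
    · rintro ⟨⟨h1, h2⟩, h3, h4⟩
      exact ⟨h1, h3, by linarith⟩
  · simp only [sub_zero]
    rw [intervalIntegral.integral_sub (by simp) (by simp)]
    norm_num

/-- This region is the regular hexagon in the coordinates given by two vertex vectors at angle
`2π/3`. -/
lemma volume_standard_hexagon :
    volume {z : ℝ × ℝ | |z.1| ≤ 1 ∧ |z.2| ≤ 1 ∧ |z.1 - z.2| ≤ 1} = 3 := by
  have := volume_between_graphs (p := -1) (q := 1) (by norm_num) (f := fun s => max (-1) (s - 1))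
    (g := fun s => min 1 (s + 1)) (by fun_prop) (by fun_prop)
    (fun s hs => by
      refine le_min (max_le (by norm_num) (by linarith [hs.2]))
        (max_le (by linarith [hs.1]) (by linarith)))
  have hI : (∫ s in (-1 : ℝ)..1, (min 1 (s + 1) - max (-1) (s - 1))) = 3 := by
    rw [← intervalIntegral.integral_add_adjacent_intervals (b := 0)]
    · have e1 : (∫ s in (-1 : ℝ)..0, (min 1 (s + 1) - max (-1) (s - 1)))
          = ∫ s in (-1 : ℝ)..0, (s + 2) := by
        apply intervalIntegral.integral_congr
        intro s hs
        rw [Set.uIcc_of_le (by norm_num)] at hs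
        simp only
        rw [min_eq_right (by linarith [hs.2]), max_eq_left (by linarith [hs.2])]
        ring
      have e2 : (∫ s in (0 : ℝ)..1, (min 1 (s + 1) - max (-1) (s - 1)))
          = ∫ s in (0 : ℝ)..1, (2 - s) := by
        apply intervalIntegral.integral_congr
        intro s hs
        rw [Set.uIcc_of_le (by norm_num)] at hs
        simp only
        rw [min_eq_left (by linarith [hs.1]), max_eq_right (by linarith [hs.1])]
        ring
      rw [e1, e2, intervalIntegral.integral_sub (by simp) (by simp)]
      norm_num
    · exact Continuous.intervalIntegrable (by fun_prop) _ _
    · exact Continuous.intervalIntegrable (by fun_prop) _ _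
  rw [hI] at this
  rw [show (3 : ENNReal) = ENNReal.ofReal 3 by norm_num, ← this]
  congr 1
  ext z
  simp only [Set.mem_ofPred_eq, Set.mem_Icc, abs_le, max_le_iff, le_min_iff]
  constructor
  · rintro ⟨⟨h1, h2⟩, ⟨h3, h4⟩, h5, h6⟩
    refine ⟨⟨h1, h2⟩, ⟨h3, ?_⟩, h4, ?_⟩ <;> linarith
  · rintro ⟨⟨h1, h2⟩, ⟨h3, h4⟩, h5, h6⟩
    refine ⟨⟨h1, h2⟩, ⟨h3, h5⟩, ?_, ?_⟩ <;> linarith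

lemma convex_image_affine (c a b : Plane) {S : Set (ℝ × ℝ)} (hS : Convex ℝ S) :
    Convex ℝ ((fun z : ℝ × ℝ => c + (z.1 • a + z.2 • b)) '' S) := by
  rintro _ ⟨z, hz, rfl⟩ _ ⟨w, hw, rfl⟩ α β hα hβ hαβ
  refine ⟨α • z + β • w, hS hz hw hα hβ hαβ, ?_⟩
  obtain rfl : β = 1 - α := by linarith
  simp only [Prod.fst_add, Prod.smul_fst, Prod.snd_add, Prod.smul_snd, smul_eq_mul]
  module

/-- Area of a triangle. -/
lemma volume_triangle_le (p : Fin 3 → Plane) :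
    volume (convexHull ℝ (Set.range p)) ≤
      ENNReal.ofReal (|cross (p 1 - p 0) (p 2 - p 0)| / 2) := by
  have h : convexHull ℝ (Set.range p) ⊆
      (fun z : ℝ × ℝ => p 0 + (z.1 • (p 1 - p 0) + z.2 • (p 2 - p 0))) ''
        {z : ℝ × ℝ | 0 ≤ z.1 ∧ 0 ≤ z.2 ∧ z.1 + z.2 ≤ 1} := by
    refine convexHull_min ?_ (convex_image_affine _ _ _ ?_)
    · rintro _ ⟨i, rfl⟩
      fin_cases i
      · exact ⟨(0, 0), by norm_num, by simp⟩
      · exact ⟨(1, 0), by norm_num, by simp⟩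
      · exact ⟨(0, 1), by norm_num, by simp⟩
    · rintro z ⟨h1, h2, h3⟩ w ⟨h4, h5, h6⟩ α β hα hβ hαβ
      refine ⟨?_, ?_, ?_⟩ <;>
        simp only [Prod.fst_add, Prod.smul_fst, Prod.snd_add, Prod.smul_snd, smul_eq_mul]
      · positivity
      · positivity
      · nlinarith
  refine (measure_mono h).trans ?_
  rw [volume_image_affine, volume_standard_triangle, ← ENNReal.ofReal_mul (abs_nonneg _)]
  apply le_of_eq
  congr 1
  ring

/-! ### The largest triangle in a disk -/

lemma cross_sq_le (a b : Plane) : cross a b ^ 2 ≤ ‖a‖ ^ 2 * ‖b‖ ^ 2 := by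
  rw [EuclideanSpace.real_norm_sq_eq, EuclideanSpace.real_norm_sq_eq, cross]
  simp only [Fin.sum_univ_two]
  nlinarith [sq_nonneg (a 0 * b 0 + a 1 * b 1)]

lemma abs_cross_le (a b : Plane) : |cross a b| ≤ ‖a‖ * ‖b‖ := by
  apply abs_le_of_sq_le_sq _ (by positivity)
  rw [mul_pow]
  exact cross_sq_le a b

/-- Twice the area of a triangle contained in a disk. -/
lemma abs_cross_le_of_norm_le {R : ℝ} (p q s : Plane) (hp : ‖p‖ ≤ R) (hq : ‖q‖ ≤ R)
    (hs : ‖s‖ ≤ R) : |cross (q - p) (s - p)| ≤ 3 * √3 / 2 * R ^ 2 := by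
  have hR : 0 ≤ R := (norm_nonneg p).trans hp
  -- Measuring `s` from the midpoint of `pq` bounds the height over this side by `‖p + q‖ / 2 + R`.
  have h1 : cross (q - p) (s - p) = (1 / 2) * cross (p + q) (q - p) + cross (q - p) s := by
    simp only [cross, PiLp.sub_apply, PiLp.add_apply]
    ring
  have h2 : |cross (q - p) (s - p)| ≤ ‖q - p‖ * (‖p + q‖ / 2 + R) := by
    rw [h1]
    refine (abs_add_le _ _).trans ?_
    rw [abs_mul, abs_of_pos (by norm_num : (0 : ℝ) < 1 / 2)]
    nlinarith [abs_cross_le (p + q) (q - p), abs_cross_le (q - p) s,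
      mul_le_mul_of_nonneg_left hs (norm_nonneg (q - p))]
  have h3 : ‖p + q‖ ^ 2 + ‖q - p‖ ^ 2 ≤ 4 * R ^ 2 := by
    have e := parallelogram_law_with_norm ℝ q p
    have : ‖q + p‖ = ‖p + q‖ := by rw [add_comm]
    rw [this] at e
    nlinarith [pow_le_pow_left₀ (norm_nonneg _) hp 2, pow_le_pow_left₀ (norm_nonneg _) hq 2]
  refine h2.trans (abs_le_of_sq_le_sq' ?_ (by positivity)).2
  rw [mul_pow, mul_pow, div_pow, mul_pow, Real.sq_sqrt (by norm_num)]
  set u := ‖p + q‖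
  have h4 : ‖q - p‖ ^ 2 * (u / 2 + R) ^ 2 ≤ (4 * R ^ 2 - u ^ 2) * (u / 2 + R) ^ 2 := by
    gcongr
    linarith
  have hu : 0 ≤ u := norm_nonneg _
  -- This product is four times the difference of the two sides to be compared; it vanishes at `u =
  -- R`, the equilateral case.
  have h5 : 0 ≤ (u - R) ^ 2 * ((u + 3 * R) ^ 2 + 2 * R ^ 2) := by positivity
  nlinarith

lemma volume_triangle_le_of_mem_closedBall {R : ℝ} (c : Plane) (p : Fin 3 → Plane)
    (hp : ∀ i, p i ∈ Metric.closedBall c R) :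
    volume (convexHull ℝ (Set.range p)) ≤ ENNReal.ofReal (3 * √3 / 4 * R ^ 2) := by
  refine (volume_triangle_le p).trans (ENNReal.ofReal_le_ofReal ?_)
  have h : ∀ i, ‖p i - c‖ ≤ R := fun i => by simpa [dist_eq_norm] using hp i
  have := abs_cross_le_of_norm_le (p 0 - c) (p 1 - c) (p 2 - c) (h 0) (h 1) (h 2)
  rw [sub_sub_sub_cancel_right, sub_sub_sub_cancel_right] at this
  linarith

/-! ### Weighted Delaunay triangles -/

/-- The affine function interpolating `h` at the vertices of the triangle `b`. -/
noncomputable def interp (b : AffineBasis (Fin 3) ℝ Plane) (h : Plane → ℝ) : Plane →ᵃ[ℝ] ℝ :=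
  ∑ i, h (b i) • b.coord i

lemma interp_apply (b : AffineBasis (Fin 3) ℝ Plane) (h : Plane → ℝ) (x : Plane) :
    interp b h x = ∑ i, b.coord i x * h (b i) := by
  simp only [interp, Fin.sum_univ_three, AffineMap.coe_add, AffineMap.coe_smul, Pi.add_apply,
    Pi.smul_apply, smul_eq_mul]
  ring

lemma interp_vertex (b : AffineBasis (Fin 3) ℝ Plane) (h : Plane → ℝ) (i : Fin 3) :
    interp b h (b i) = h (b i) := by
  rw [interp_apply]
  simp [AffineBasis.coord_apply]

lemma affineMap_eq_sum_coord (b : AffineBasis (Fin 3) ℝ Plane) (f : Plane →ᵃ[ℝ] ℝ) (x : Plane) :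
    f x = ∑ i, b.coord i x * f (b i) := by
  have hs := b.sum_coord_apply_eq_one x
  conv_lhs => rw [← b.affineCombination_coord_eq_self x]
  rw [Finset.map_affineCombination _ _ _ hs,
    Finset.affineCombination_eq_linear_combination _ _ _ hs]
  rfl

/-- A triangle with vertices in `P` whose interpolant lies below the heights `h`: a cell of the
weighted Delaunay subdivision. -/
structure IsDelaunay (P : Finset Plane) (h : Plane → ℝ) (b : AffineBasis (Fin 3) ℝ Plane) :
    Prop where
  mem : ∀ i, b i ∈ P
  le : ∀ q ∈ P, interp b h q ≤ h q

/-- No four lifted points are coplanar. -/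
def IsGenericHeight (P : Finset Plane) (h : Plane → ℝ) : Prop :=
  ∀ b : AffineBasis (Fin 3) ℝ Plane, (∀ i, b i ∈ P) → ∀ q ∈ P, interp b h q = h q →
    q ∈ Set.range b

/-- Each interpolant is maximal among Delaunay interpolants on its own triangle, so the two agree at
a common interior point. There the gaps at the vertices of `b` are nonnegative and have a positively
weighted sum equal to zero. -/
lemma IsDelaunay.vertex_eq {P : Finset Plane} {h : Plane → ℝ} {b b' : AffineBasis (Fin 3) ℝ Plane}
    (hb : IsDelaunay P h b) (hb' : IsDelaunay P h b') {x : Plane} (hx : ∀ i, 0 < b.coord i x)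
    (hx' : ∀ i, 0 < b'.coord i x) (i : Fin 3) : interp b' h (b i) = h (b i) := by
  have key : ∀ {b b' : AffineBasis (Fin 3) ℝ Plane}, IsDelaunay P h b → IsDelaunay P h b' →
      (∀ i, 0 < b.coord i x) → interp b' h x ≤ interp b h x := by
    intro b b' hb hb' hx
    rw [affineMap_eq_sum_coord b, interp_apply b]
    exact Finset.sum_le_sum fun i _ => mul_le_mul_of_nonneg_left (hb'.le _ (hb.mem i)) (hx i).le
  have heq := le_antisymm (key hb hb' hx) (key hb' hb hx')
  rw [affineMap_eq_sum_coord b, interp_apply b] at heq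
  have := (Finset.sum_eq_sum_iff_of_le fun i _ =>
    mul_le_mul_of_nonneg_left (hb'.le _ (hb.mem i)) (hx i).le).1 heq i (Finset.mem_univ i)
  exact mul_left_cancel₀ (hx i).ne' this

/-- Distinct Delaunay triangles do not overlap. -/
lemma IsDelaunay.range_eq {P : Finset Plane} {h : Plane → ℝ} (hh : IsGenericHeight P h)
    {b b' : AffineBasis (Fin 3) ℝ Plane}
    (hb : IsDelaunay P h b) (hb' : IsDelaunay P h b') {x : Plane} (hx : ∀ i, 0 < b.coord i x)
    (hx' : ∀ i, 0 < b'.coord i x) : Set.range b = Set.range b' := by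
  apply Set.Subset.antisymm
  · rintro _ ⟨i, rfl⟩
    exact hh b' hb'.mem _ (hb.mem i) (hb.vertex_eq hb' hx hx' i)
  · rintro _ ⟨i, rfl⟩
    exact hh b hb.mem _ (hb'.mem i) (hb'.vertex_eq hb hx' hx i)

lemma finite_affineBasis (P : Finset Plane) :
    {b : AffineBasis (Fin 3) ℝ Plane | ∀ i, b i ∈ P}.Finite := by
  have : (Set.univ.pi fun _ : Fin 3 => (P : Set Plane)).Finite :=
    Set.Finite.pi fun _ => P.finite_toSet
  refine Set.Finite.of_finite_image (f := fun b : AffineBasis (Fin 3) ℝ Plane => (b : Fin 3 → Plane))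
    (this.subset ?_) ?_
  · rintro _ ⟨b, hb, rfl⟩ i _
    exact hb i
  · intro b _ b' _ h
    exact AffineBasis.ext h

/-- The heights are `‖p‖ ^ 2 + t ^ k p` with distinct positive exponents on `P`. Coplanarity of four
lifted points is a nonzero polynomial condition on `t`, so only finitely many `t` are bad. -/
lemma exists_isGenericHeight (P : Finset Plane) {δ : ℝ} (hδ : 0 < δ) :
    ∃ h : Plane → ℝ, (∀ p, |h p - ‖p‖ ^ 2| ≤ δ) ∧ IsGenericHeight P h := by
  classical
  let k : Plane → ℕ := fun p => if hp : p ∈ P then (P.equivFin ⟨p, hp⟩ : ℕ) + 1 else 1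
  have hk1 : ∀ p, k p ≠ 0 := by
    intro p
    simp only [k]
    split_ifs <;> omega
  have hk : ∀ p ∈ P, ∀ q ∈ P, k p = k q → p = q := by
    intro p hp q hq h
    simp only [k, hp, hq, dif_pos, add_left_inj] at h
    have := P.equivFin.injective (Fin.ext h)
    simpa using this
  let f : AffineBasis (Fin 3) ℝ Plane → Plane → Polynomial ℝ := fun b q =>
    Polynomial.X ^ k q + Polynomial.C (‖q‖ ^ 2) -
      ∑ i, Polynomial.C (b.coord i q) * (Polynomial.X ^ k (b i) + Polynomial.C (‖b i‖ ^ 2))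
  have hf : ∀ b : AffineBasis (Fin 3) ℝ Plane, (∀ i, b i ∈ P) → ∀ q ∈ P, q ∉ Set.range b →
      f b q ≠ 0 := by
    intro b hb q hq hqb h0
    -- The vertices carry other exponents and the constants sit in degree `0`, so nothing cancels `X
    -- ^ k q`.
    have h1 : (f b q).coeff (k q) = 1 := by
      have h2 : ∀ i, k q ≠ k (b i) := fun i h => hqb ⟨i, (hk _ hq _ (hb i) h).symm⟩
      simp only [f, Polynomial.coeff_sub, Polynomial.coeff_add, Polynomial.finsetSum_coeff,
        Polynomial.coeff_C_mul, Polynomial.coeff_X_pow, Polynomial.coeff_C, hk1, h2, if_true,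
        if_false]
      simp
    rw [h0] at h1
    simp at h1
  let bad : Set ℝ := ⋃ b ∈ {b : AffineBasis (Fin 3) ℝ Plane | ∀ i, b i ∈ P}, ⋃ q ∈ (P : Set Plane),
    ((f b q).roots.toFinset : Set ℝ)
  have hbad : bad.Finite := (finite_affineBasis P).biUnion fun b _ =>
    P.finite_toSet.biUnion fun q _ => Finset.finite_toSet _
  obtain ⟨t, ⟨ht0, ht1⟩, htb⟩ := ((Set.Ioo_infinite (lt_min hδ one_pos)).sdiff hbad).nonempty
  refine ⟨fun p => t ^ k p + ‖p‖ ^ 2, fun p => ?_, fun b hb q hq hbq => ?_⟩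
  · rw [add_sub_cancel_right, abs_of_nonneg (by positivity)]
    exact (pow_le_of_le_one ht0.le (ht1.le.trans (min_le_right _ _)) (hk1 p)).trans
      (ht1.le.trans (min_le_left _ _))
  · by_contra hqb
    apply htb
    simp only [bad, Set.mem_iUnion]
    refine ⟨b, hb, q, hq, ?_⟩
    rw [Finset.mem_coe, Multiset.mem_toFinset, Polynomial.mem_roots (hf b hb q hq hqb),
      Polynomial.IsRoot]
    rw [interp_apply] at hbq
    simp only [f, Polynomial.eval_sub, Polynomial.eval_add, Polynomial.eval_pow, Polynomial.eval_X,
      Polynomial.eval_C, Polynomial.eval_finsetSum, Polynomial.eval_mul]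
    rw [hbq, sub_self]

/-- A triangle with vertices in `P` around every generic point of the convex hull. -/
lemma exists_affineBasis_of_mem_convexHull {P : Finset Plane} {x : Plane}
    (hx : x ∈ convexHull ℝ (P : Set Plane))
    (hgen : ∀ p ∈ P, ∀ q ∈ P, x ∉ affineSpan ℝ ({p, q} : Set Plane)) :
    ∃ b : AffineBasis (Fin 3) ℝ Plane, (∀ i, b i ∈ P) ∧ ∀ i, 0 ≤ b.coord i x := by
  classical
  -- Carathéodory: at most three affinely independent points are needed, and two or fewer would put
  -- `x` on an excluded line.
  obtain ⟨ι, _, z, w, hz, hzi, hw, hw1, hwx⟩ := eq_pos_convex_span_of_mem_convexHull hx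
  have hzP : ∀ i, z i ∈ P := fun i => hz ⟨i, rfl⟩
  have hxs : x ∈ affineSpan ℝ (Set.range z) := by
    rw [← hwx, ← Finset.affineCombination_eq_linear_combination _ _ _ hw1]
    exact affineCombination_mem_affineSpan hw1 z
  have hcard : Fintype.card ι = 3 := by
    have h1 := hzi.card_le_finrank_succ
    have h2 : Module.finrank ℝ (vectorSpan ℝ (Set.range z)) ≤ 2 := by
      simpa using Submodule.finrank_le (vectorSpan ℝ (Set.range z))
    by_contra h3
    have h4 : Fintype.card ι ≤ 2 := by omega
    have hne : Nonempty ι := by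
      by_contra h
      rw [not_nonempty_iff] at h
      simp at hw1
    obtain ⟨i⟩ := hne
    have h5 : (Finset.univ.erase i).card ≤ 1 := by
      rw [Finset.card_erase_of_mem (Finset.mem_univ _), Finset.card_univ]
      omega
    obtain ⟨j, hj⟩ : ∃ j, ∀ l, l = i ∨ l = j := by
      rcases (Finset.univ.erase i).eq_empty_or_nonempty with h | ⟨j, hj⟩
      · refine ⟨i, fun l => ?_⟩
        by_contra hl
        have : l ∈ Finset.univ.erase i := by simp; tauto
        rw [h] at this
        simp at this
      · refine ⟨j, fun l => ?_⟩
        by_cases hl : l = i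
        · exact Or.inl hl
        · exact Or.inr (Finset.card_le_one.1 h5 l (by simp [hl]) j hj)
    refine hgen _ (hzP i) _ (hzP j) (affineSpan_mono ℝ ?_ hxs)
    rintro _ ⟨l, rfl⟩
    rcases hj l with rfl | rfl <;> simp
  have htop : affineSpan ℝ (Set.range z) = ⊤ :=
    hzi.affineSpan_eq_top_iff_card_eq_finrank_add_one.2 (by simp [hcard])
  let e : ι ≃ Fin 3 := Fintype.equivFinOfCardEq hcard
  let b : AffineBasis ι ℝ Plane := ⟨z, hzi, htop⟩
  refine ⟨b.reindex e, fun i => hzP _, fun i => ?_⟩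
  have h6 : b.coord (e.symm i) x = w (e.symm i) := by
    rw [← hwx, ← Finset.affineCombination_eq_linear_combination _ _ _ hw1]
    exact b.coord_apply_combination_of_mem (Finset.mem_univ _) hw1
  rw [b.coord_reindex, h6]
  exact (hw _).le

lemma coord_pos_of_nonneg {P : Finset Plane} {x : Plane}
    (hgen : ∀ p ∈ P, ∀ q ∈ P, x ∉ affineSpan ℝ ({p, q} : Set Plane))
    {b : AffineBasis (Fin 3) ℝ Plane} (hb : ∀ i, b i ∈ P) (hx : ∀ i, 0 ≤ b.coord i x) (i : Fin 3) :
    0 < b.coord i x := by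
  refine lt_of_le_of_ne (hx i) fun h0 => ?_
  have hs := b.sum_coord_apply_eq_one x
  have hl := b.linear_combination_coord_eq_self x
  rw [Fin.sum_univ_three] at hs hl
  have key : ∀ (p q : Plane) (s t : ℝ), s + t = 1 → s • p + t • q = x →
      x ∈ affineSpan ℝ ({p, q} : Set Plane) := by
    intro p q s t hst hx
    obtain rfl : s = 1 - t := by linarith
    rw [← hx, ← AffineMap.lineMap_apply_module]
    exact AffineMap.lineMap_mem_affineSpan_pair t p q
  obtain rfl | rfl | rfl : i = 0 ∨ i = 1 ∨ i = 2 := by omega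
  · rw [← h0] at hs hl
    rw [zero_smul, zero_add] at hl
    exact hgen _ (hb 1) _ (hb 2) (key _ _ _ _ (by linarith) hl)
  · rw [← h0] at hs hl
    rw [zero_smul, add_zero] at hl
    exact hgen _ (hb 0) _ (hb 2) (key _ _ _ _ (by linarith) hl)
  · rw [← h0] at hs hl
    rw [zero_smul, add_zero] at hl
    exact hgen _ (hb 0) _ (hb 1) (key _ _ _ _ (by linarith) hl)

/-- Every generic point of the convex hull lies in a Delaunay triangle. -/
lemma exists_isDelaunay {P : Finset Plane} (h : Plane → ℝ) {x : Plane}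
    (hx : x ∈ convexHull ℝ (P : Set Plane))
    (hgen : ∀ p ∈ P, ∀ q ∈ P, x ∉ affineSpan ℝ ({p, q} : Set Plane)) :
    ∃ b : AffineBasis (Fin 3) ℝ Plane, IsDelaunay P h b ∧ ∀ i, 0 ≤ b.coord i x := by
  classical
  let B : Set (AffineBasis (Fin 3) ℝ Plane) := {b | (∀ i, b i ∈ P) ∧ ∀ i, 0 ≤ b.coord i x}
  have hB : B.Finite := (finite_affineBasis P).subset fun b hb => hb.1
  have hBne : B.Nonempty := exists_affineBasis_of_mem_convexHull hx hgen
  -- Among the triangles around `x`, take one whose interpolant is lowest at `x`. A lifted point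
  -- below its plane would allow a simplex pivot to a lower one.
  obtain ⟨b, ⟨hbP, hbx⟩, hmin⟩ := hB.exists_minimalFor (fun b => interp b h x) B hBne
  refine ⟨b, ⟨hbP, fun q hq => ?_⟩, hbx⟩
  by_contra! hlt
  have hpos := coord_pos_of_nonneg hgen hbP hbx
  -- Ratio test: replacing by `q` the vertex with the least ratio keeps the coordinates of `x`
  -- nonnegative.
  obtain ⟨i, hi, himin⟩ : ∃ i, 0 < b.coord i q ∧
      ∀ j, 0 < b.coord j q → b.coord i x / b.coord i q ≤ b.coord j x / b.coord j q := by
    have hne : (Finset.univ.filter fun i => 0 < b.coord i q).Nonempty := by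
      have hs := b.sum_coord_apply_eq_one q
      obtain ⟨i, -, hi⟩ := Finset.exists_lt_of_sum_lt (s := Finset.univ) (f := fun _ : Fin 3 => (0 : ℝ))
        (g := fun i => b.coord i q) (by rw [hs]; simp)
      exact ⟨i, by simpa using hi⟩
    obtain ⟨i, hi, himin⟩ := Finset.exists_min_image _
      (fun i => b.coord i x / b.coord i q) hne
    exact ⟨i, by simpa using hi, fun j hj => himin j (by simpa using hj)⟩
  -- The `i`-th coordinate vanishes on the opposite side but is positive at `q`, so the new triple
  -- is still a triangle.
  have hnot : q ∉ affineSpan ℝ (b '' {j | j ≠ i}) := by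
    intro hqs
    have : b.coord i q ∈ (affineSpan ℝ (b '' {j | j ≠ i})).map (b.coord i) := ⟨q, hqs, rfl⟩
    rw [AffineSubspace.map_span] at this
    have hsub : (b.coord i) '' (b '' {j | j ≠ i}) ⊆ {0} := by
      rintro _ ⟨_, ⟨j, hj, rfl⟩, rfl⟩
      exact b.coord_apply_ne (Ne.symm hj)
    have := affineSpan_mono ℝ hsub this
    rw [AffineSubspace.mem_affineSpan_singleton] at this
    exact hi.ne' this
  have hind := b.ind.affineIndependent_update_of_notMem_affineSpan hnot
  let b' : AffineBasis (Fin 3) ℝ Plane := ⟨Function.update b i q, hind,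
    hind.affineSpan_eq_top_iff_card_eq_finrank_add_one.2 (by simp)⟩
  have hb'i : b' i = q := Function.update_self _ _ _
  have hb'j : ∀ j, j ≠ i → b' j = b j := fun j hj => Function.update_of_ne hj _ _
  have hsum : ∀ f : Plane →ᵃ[ℝ] ℝ, f x = b'.coord i x * f q +
      ∑ j ∈ Finset.univ.erase i, b'.coord j x * f (b j) := by
    intro f
    rw [affineMap_eq_sum_coord b' f x, ← Finset.add_sum_erase _ _ (Finset.mem_univ i), hb'i]
    congr 1
    exact Finset.sum_congr rfl fun j hj => by rw [hb'j j (Finset.ne_of_mem_erase hj)]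
  have hi' : b.coord i x = b'.coord i x * b.coord i q := by
    rw [hsum (b.coord i), add_eq_left]
    exact Finset.sum_eq_zero fun j hj => by
      rw [b.coord_apply_ne (Finset.ne_of_mem_erase hj).symm, mul_zero]
  have hj' : ∀ j, j ≠ i → b.coord j x = b'.coord i x * b.coord j q + b'.coord j x := by
    intro j hj
    rw [hsum (b.coord j), Finset.sum_eq_single_of_mem j (Finset.mem_erase.2 ⟨hj, Finset.mem_univ j⟩),
      b.coord_apply_eq, mul_one]
    intro l _ hl
    rw [b.coord_apply_ne hl.symm, mul_zero]
  have ht : b'.coord i x = b.coord i x / b.coord i q := by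
    rw [hi']
    field_simp
  have htpos : 0 < b'.coord i x := by
    rw [ht]
    exact div_pos (hpos i) hi
  have hmem : b' ∈ B := by
    refine ⟨fun j => ?_, fun j => ?_⟩
    · by_cases hj : j = i
      · rw [hj, hb'i]
        exact hq
      · rw [hb'j j hj]
        exact hbP j
    · by_cases hj : j = i
      · rw [hj]
        exact htpos.le
      · have h1 := hj' j hj
        have h2 := hpos j
        rcases le_or_gt (b.coord j q) 0 with h3 | h3
        · nlinarith [mul_nonneg htpos.le (neg_nonneg.2 h3)]
        · have h4 := himin j h3
          rw [← ht, le_div_iff₀ h3] at h4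
          linarith
  have hlt' : interp b' h x < interp b h x := by
    rw [hsum (interp b h), affineMap_eq_sum_coord b' (interp b' h) x,
      ← Finset.add_sum_erase _ _ (Finset.mem_univ i), interp_vertex, hb'i]
    refine add_lt_add_of_lt_of_le (mul_lt_mul_of_pos_left hlt htpos) (le_of_eq ?_)
    refine Finset.sum_congr rfl fun j hj => ?_
    rw [interp_vertex, interp_vertex, hb'j j (Finset.ne_of_mem_erase hj)]
  exact absurd (hmin hmem hlt'.le) (not_le.2 hlt')

/-! ### Counting Delaunay triangles -/

/-- A direction that is parallel to no side of the triangles spanned by `P`. -/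
lemma exists_generic_direction (P : Finset Plane) :
    ∃ u : Plane, ∀ b : AffineBasis (Fin 3) ℝ Plane, (∀ i, b i ∈ P) → ∀ i,
      (b.coord i).linear u ≠ 0 := by
  have := (finite_affineBasis P).to_subtype
  obtain ⟨u, hu⟩ := Module.Dual.exists_forall_ne_zero_of_forall_exists (K := ℝ) (M := Plane)
    (ι := {b : AffineBasis (Fin 3) ℝ Plane | ∀ i, b i ∈ P} × Fin 3)
    (fun bi => (bi.1.1.coord bi.2).linear) (by
      rintro ⟨⟨b, hb⟩, i⟩
      refine ⟨b i - b (i + 1), ?_⟩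
      have : i ≠ i + 1 := by omega
      simp only
      rw [← vsub_eq_sub, AffineMap.linearMap_vsub, b.coord_apply_eq, b.coord_apply_ne this]
      simp)
  exact ⟨u, fun b hb i => hu ⟨⟨b, hb⟩, i⟩⟩

/-- A line through a triangle in a generic direction enters it at exactly one vertex. -/
lemma exists_vertex_of_direction (b : AffineBasis (Fin 3) ℝ Plane) {u : Plane}
    (hu : ∀ i, (b.coord i).linear u ≠ 0) :
    ∃ i, ∃ s ∈ ({1, -1} : Finset ℝ), ∀ᶠ ε : ℝ in nhdsWithin 0 (Set.Ioi 0),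
      ∀ j, 0 < b.coord j (b i + (s * ε) • u) := by
  have hsum : ∑ i, (b.coord i).linear u = 0 := by
    have h : ∀ i, (b.coord i).linear u = b.coord i u - b.coord i 0 := fun i => by
      rw [← vsub_eq_sub (b.coord i u), ← AffineMap.linearMap_vsub]
      simp
    simp_rw [h]
    rw [Finset.sum_sub_distrib, b.sum_coord_apply_eq_one, b.sum_coord_apply_eq_one, sub_self]
  -- Of three nonzero reals with sum zero, exactly two share a sign. The vertex is that of the
  -- third, and `s` is the shared sign.
  have key : ∃ i, ∃ s ∈ ({1, -1} : Finset ℝ), ∀ j, j ≠ i → 0 < s * (b.coord j).linear u := by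
    rw [Fin.sum_univ_three] at hsum
    have h0 := hu 0
    have h1 := hu 1
    have h2 := hu 2
    have hs : ∀ (i : Fin 3) (s : ℝ), s = 1 ∨ s = -1 →
        0 < s * (b.coord (i + 1)).linear u → 0 < s * (b.coord (i + 2)).linear u →
        ∃ i, ∃ s ∈ ({1, -1} : Finset ℝ), ∀ j, j ≠ i → 0 < s * (b.coord j).linear u := by
      intro i s hs h1 h2
      refine ⟨i, s, by simpa using hs, fun j hj => ?_⟩
      obtain rfl | rfl : j = i + 1 ∨ j = i + 2 := by omega
      · exact h1
      · exact h2
    have a0 := hs 0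
    have a1 := hs 1
    have a2 := hs 2
    simp only [zero_add, Fin.reduceAdd] at a0 a1 a2
    rcases lt_or_gt_of_ne h0 with h0 | h0 <;> rcases lt_or_gt_of_ne h1 with h1 | h1 <;>
      rcases lt_or_gt_of_ne h2 with h2 | h2
    · linarith
    · exact a2 (-1) (Or.inr rfl) (by linarith) (by linarith)
    · exact a1 (-1) (Or.inr rfl) (by linarith) (by linarith)
    · exact a0 1 (Or.inl rfl) (by linarith) (by linarith)
    · exact a0 (-1) (Or.inr rfl) (by linarith) (by linarith)
    · exact a1 1 (Or.inl rfl) (by linarith) (by linarith)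
    · exact a2 1 (Or.inl rfl) (by linarith) (by linarith)
    · linarith
  obtain ⟨i, s, hs, hpos⟩ := key
  refine ⟨i, s, hs, ?_⟩
  have hval : ∀ (j : Fin 3) (ε : ℝ), b.coord j (b i + (s * ε) • u) =
      ε * (s * (b.coord j).linear u) + b.coord j (b i) := by
    intro j ε
    have h := (b.coord j).map_vadd (b i) ((s * ε) • u)
    rw [vadd_eq_add, vadd_eq_add, add_comm, map_smul, smul_eq_mul] at h
    rw [h]
    ring
  rw [Filter.eventually_all]
  intro j
  by_cases hj : j = i
  · subst hj
    have ht : Tendsto (fun ε : ℝ => b.coord j (b j + (s * ε) • u)) (nhdsWithin 0 (Set.Ioi 0))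
        (nhds 1) := by
      apply tendsto_nhdsWithin_of_tendsto_nhds
      simp_rw [hval, b.coord_apply_eq]
      have : Continuous fun ε : ℝ => ε * (s * (b.coord j).linear u) + 1 := by fun_prop
      simpa using this.tendsto 0
    exact ht.eventually (lt_mem_nhds one_pos)
  · filter_upwards [self_mem_nhdsWithin] with ε hε
    rw [hval, b.coord_apply_ne hj, add_zero]
    exact mul_pos hε (hpos j hj)

/-- There are at most twice as many Delaunay triangles as points. -/
lemma card_delaunay_le {P : Finset Plane} {h : Plane → ℝ} (hh : IsGenericHeight P h)
    (T : Finset (Finset Plane))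
    (hT : ∀ t ∈ T, ∃ b, IsDelaunay P h b ∧ (t : Set Plane) = Set.range b) :
    T.card ≤ 2 * P.card := by
  obtain ⟨u, hu⟩ := exists_generic_direction P
  rcases T.eq_empty_or_nonempty with rfl | ⟨t₀, ht₀⟩
  · simp
  have : Nonempty (AffineBasis (Fin 3) ℝ Plane) := ⟨(hT t₀ ht₀).choose⟩
  choose! b hb hbt using hT
  have hv := fun t (ht : t ∈ T) => exists_vertex_of_direction (b t) (hu (b t) (hb t ht).mem)
  choose! i s hs hpos using hv
  have hcard : (P ×ˢ ({1, -1} : Finset ℝ)).card = 2 * P.card := by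
    rw [Finset.card_product, Finset.card_pair (by norm_num), mul_comm]
  rw [← hcard]
  -- Triangles with the same vertex and sign share the points just beyond that vertex in direction
  -- `s • u`, which are interior to both; hence they coincide.
  refine Finset.card_le_card_of_injOn (fun t => (b t (i t), s t)) ?_ ?_
  · intro t ht
    exact Finset.mem_coe.2 (Finset.mem_product.2 ⟨(hb t ht).mem _, hs t ht⟩)
  · intro t ht t' ht' heq
    simp only [Prod.mk.injEq] at heq
    obtain ⟨ε, h1, h2⟩ := ((hpos t ht).and (hpos t' ht')).exists
    rw [← heq.1, ← heq.2] at h2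
    apply Finset.coe_injective
    rw [hbt t ht, hbt t' ht']
    exact (hb t ht).range_eq hh (hb t' ht') h1 h2

/-! ### Circumradii and Kershner's theorem -/

lemma volume_affineSpan_pair (p q : Plane) :
    volume (affineSpan ℝ ({p, q} : Set Plane) : Set Plane) = 0 := by
  apply Measure.addHaar_affineSubspace
  intro h
  have h1 := (collinear_pair ℝ p q).finrank_le_one
  rw [← direction_affineSpan, h, AffineSubspace.direction_top, finrank_top] at h1
  simp at h1

/-- Points of a well-covered ball lie in the convex hull of the centres. -/
lemma mem_convexHull_of_cover {P : Finset Plane} {r ρ : ℝ} (hr : 0 < r)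
    (hP : ∀ y ∈ Metric.closedBall (0 : Plane) ρ, ∃ p ∈ P, dist p y ≤ r) {x : Plane}
    (hx : x ∈ Metric.closedBall (0 : Plane) (ρ - 3 * r)) : x ∈ convexHull ℝ (P : Set Plane) := by
  by_contra hnot
  obtain ⟨f, m, hf, hm⟩ := geometric_hahn_banach_closed_point (convex_convexHull ℝ (P : Set Plane))
    (P.finite_toSet.isCompact_convexHull (𝕜 := ℝ)).isClosed hnot
  set v := (InnerProductSpace.toDual ℝ Plane).symm f with hv
  have hfv : ∀ y, f y = inner ℝ v y := fun y => by
    rw [hv, InnerProductSpace.toDual_symm_apply]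
  rw [mem_closedBall_zero_iff] at hx
  -- Moving `2r` from `x` along the separating normal stays in the covered ball, and a centre within
  -- `r` of the new point is not below `x` for `f`. If `v = 0`, the quotient is `0` and the
  -- contradiction persists.
  obtain ⟨q, hq, hqy⟩ := hP (x + (2 * r / ‖v‖) • v) (by
    rw [mem_closedBall_zero_iff]
    refine (norm_add_le _ _).trans ?_
    have : ‖(2 * r / ‖v‖) • v‖ ≤ 2 * r := by
      rw [norm_smul, Real.norm_of_nonneg (by positivity)]
      rcases eq_or_ne ‖v‖ 0 with h | h
      · rw [h, mul_zero]
        positivity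
      · rw [div_mul_cancel₀ _ h]
    linarith)
  have h1 := hf q (subset_convexHull ℝ _ hq)
  have h2 : f q = f x + 2 * r * ‖v‖ + inner ℝ v (q - (x + (2 * r / ‖v‖) • v)) := by
    rw [hfv, hfv, inner_sub_right, inner_add_right, inner_smul_right, real_inner_self_eq_norm_sq]
    have : 2 * r / ‖v‖ * ‖v‖ ^ 2 = 2 * r * ‖v‖ := by
      rcases eq_or_ne ‖v‖ 0 with h | h
      · rw [h]; simp
      · field_simp
    rw [this]
    ring
  have h3 := neg_le_of_abs_le (abs_real_inner_le_norm v (q - (x + (2 * r / ‖v‖) • v)))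
  rw [dist_eq_norm] at hqy
  have h4 := mul_le_mul_of_nonneg_left hqy (norm_nonneg v)
  nlinarith [mul_nonneg hr.le (norm_nonneg v)]

/-- The vertices of a Delaunay triangle deep inside a covered ball lie in a small disk. -/
lemma IsDelaunay.exists_closedBall {P : Finset Plane} {h : Plane → ℝ}
    {b : AffineBasis (Fin 3) ℝ Plane} (hb : IsDelaunay P h b) {r ρ δ : ℝ} (hr : 0 < r)
    (hδr : δ ≤ r ^ 2)
    (hh : ∀ p, |h p - ‖p‖ ^ 2| ≤ δ)
    (hP : ∀ y ∈ Metric.closedBall (0 : Plane) ρ, ∃ p ∈ P, dist p y ≤ r) {x : Plane}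
    (hx : x ∈ Metric.closedBall (0 : Plane) (ρ - 3 * r)) (hxb : ∀ i, 0 ≤ b.coord i x) :
    -- With `c` half the gradient of the interpolant `f`, the quantity `‖y‖ ^ 2 - f y` is the power
    -- of `y` with respect to the circle of centre `c` and squared radius `σ2`. Up to `δ`, the
    -- vertices lie on or inside this circle and no point of `P` lies strictly inside it.
    ∃ c, ∀ i, b i ∈ Metric.closedBall c √(r ^ 2 + 2 * δ) := by
  set f := interp b h with hf
  set c : Plane := (1 / 2 : ℝ) • (InnerProductSpace.toDual ℝ Plane).symm
    (LinearMap.toContinuousLinearMap f.linear) with hc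
  have hfc : ∀ y, f y = f 0 + 2 * inner ℝ c y := by
    intro y
    rw [hc, real_inner_smul_left, InnerProductSpace.toDual_symm_apply,
      LinearMap.coe_toContinuousLinearMap', f.decomp', Pi.sub_apply]
    ring
  set σ2 := ‖c‖ ^ 2 + f 0 with hσ
  have hdist : ∀ y, ‖y - c‖ ^ 2 = σ2 + (‖y‖ ^ 2 - f y) := by
    intro y
    rw [norm_sub_sq_real, hfc y, real_inner_comm, hσ]
    ring
  have hvert : ∀ i, ‖b i - c‖ ^ 2 ≤ σ2 + δ := fun i => by
    rw [hdist, hf, interp_vertex]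
    linarith [(abs_le.1 (hh (b i))).1]
  have hP' : ∀ q ∈ P, σ2 - δ ≤ ‖q - c‖ ^ 2 := fun q hq => by
    rw [hdist]
    linarith [(abs_le.1 (hh q)).2, hb.le q hq]
  have hσδ : 0 ≤ σ2 + δ := (sq_nonneg _).trans (hvert 0)
  have hmem : ∀ i, b i ∈ Metric.closedBall c √(σ2 + δ) := fun i => by
    rw [mem_closedBall_iff_norm]
    exact Real.le_sqrt_of_sq_le (hvert i)
  refine ⟨c, fun i => Metric.closedBall_subset_closedBall (Real.sqrt_le_sqrt ?_) (hmem i)⟩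
  by_cases hcρ : c ∈ Metric.closedBall (0 : Plane) ρ
  · obtain ⟨q, hq, hqc⟩ := hP c hcρ
    rw [dist_eq_norm] at hqc
    have := pow_le_pow_left₀ (norm_nonneg _) hqc 2
    linarith [hP' q hq]
  · exfalso
    have hxc : x ∈ Metric.closedBall c √(σ2 + δ) := by
      have hx' : x ∈ convexHull ℝ (Set.range b) := by
        rw [b.convexHull_eq_nonneg_coord]
        exact hxb
      refine convexHull_min ?_ (convex_closedBall _ _) hx'
      rintro _ ⟨i, rfl⟩
      exact hmem i
    rw [mem_closedBall_iff_norm] at hxc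
    have hxc2 : ‖x - c‖ ^ 2 ≤ σ2 + δ := by
      rw [← Real.sq_sqrt hσδ]
      exact pow_le_pow_left₀ (norm_nonneg _) hxc 2
    rw [mem_closedBall_zero_iff] at hcρ hx
    have hd : 3 * r < ‖x - c‖ := by
      have := norm_sub_norm_le c x
      rw [norm_sub_rev] at this
      linarith
    have hd0 : 0 < ‖x - c‖ := by linarith
    set d := ‖x - c‖ with hddef
    -- If `c` lay outside the covered ball, walking `3r` from `x` towards `c` would reach a covered
    -- point. Its centre `q` is within `d - 2r` of `c`, too deep inside the circle when `δ ≤ r ^ 2`.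
    obtain ⟨q, hq, hqy⟩ := hP (x + (3 * r / d) • (c - x)) (by
      rw [mem_closedBall_zero_iff]
      refine (norm_add_le _ _).trans ?_
      rw [norm_smul, norm_sub_rev, ← hddef, Real.norm_of_nonneg (by positivity),
        div_mul_cancel₀ _ hd0.ne']
      linarith)
    have hyc : ‖x + (3 * r / d) • (c - x) - c‖ = d - 3 * r := by
      have : x + (3 * r / d) • (c - x) - c = (1 - 3 * r / d) • (x - c) := by module
      have h2 : 3 * r / d ≤ 1 := by
        rw [div_le_one hd0]
        exact hd.le
      rw [this, norm_smul, Real.norm_of_nonneg (by linarith), ← hddef]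
      field_simp
    have hqc : ‖q - c‖ ≤ d - 2 * r := by
      have h1 := norm_add_le (q - (x + (3 * r / d) • (c - x))) (x + (3 * r / d) • (c - x) - c)
      rw [sub_add_sub_cancel, hyc] at h1
      rw [dist_eq_norm] at hqy
      linarith
    have h5 := pow_le_pow_left₀ (norm_nonneg _) hqc 2
    have h6 := hP' q hq
    nlinarith

/-- **Kershner's theorem**, finite form: if finitely many disks of radius `r` cover a disk of radius
`ρ`, their number is at least the area of a slightly smaller disk divided by the area of the regular
hexagon inscribed in a disk of radius `r`. -/
theorem volume_closedBall_le_card_mul {P : Finset Plane} {r ρ : ℝ} (hr : 0 < r)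
    (hP : ∀ y ∈ Metric.closedBall (0 : Plane) ρ, ∃ p ∈ P, dist p y ≤ r) :
    volume (Metric.closedBall (0 : Plane) (ρ - 3 * r)) ≤
      P.card * ENNReal.ofReal (3 * √3 / 2 * r ^ 2) := by
  classical
  have key : ∀ δ : ℝ, 0 < δ → δ ≤ r ^ 2 →
      volume (Metric.closedBall (0 : Plane) (ρ - 3 * r)) ≤
        ENNReal.ofReal (P.card * (3 * √3 / 2 * (r ^ 2 + 2 * δ))) := by
    intro δ hδ hδr
    obtain ⟨h, hh, hgen⟩ := exists_isGenericHeight P hδ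
    set R := √(r ^ 2 + 2 * δ) with hR
    -- Triangles are recorded as vertex sets, since an affine basis also carries an ordering.
    let T : Finset (Finset Plane) := P.powerset.filter fun t =>
      ∃ b, IsDelaunay P h b ∧ (t : Set Plane) = Set.range b ∧
        ∃ c, ∀ i, b i ∈ Metric.closedBall c R
    have hcard : T.card ≤ 2 * P.card := by
      refine card_delaunay_le hgen T fun t ht => ?_
      obtain ⟨b, hb, hbt, -⟩ := (Finset.mem_filter.1 ht).2
      exact ⟨b, hb, hbt⟩
    have hcover : Metric.closedBall (0 : Plane) (ρ - 3 * r) ⊆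
        (⋃ p ∈ P, ⋃ q ∈ P, (affineSpan ℝ ({p, q} : Set Plane) : Set Plane)) ∪
          ⋃ t ∈ T, convexHull ℝ (t : Set Plane) := by
      intro x hx
      by_cases hxg : ∀ p ∈ P, ∀ q ∈ P, x ∉ affineSpan ℝ ({p, q} : Set Plane)
      · obtain ⟨b, hb, hbx⟩ := exists_isDelaunay h (mem_convexHull_of_cover hr hP hx) hxg
        refine Or.inr (Set.mem_iUnion₂.2 ⟨Finset.univ.image b, ?_, ?_⟩)
        · refine Finset.mem_filter.2 ⟨Finset.mem_powerset.2 ?_, b, hb, by simp,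
            hb.exists_closedBall hr hδr hh hP hx hbx⟩
          intro q hq
          obtain ⟨i, -, rfl⟩ := Finset.mem_image.1 hq
          exact hb.mem i
        · rw [Finset.coe_image, Finset.coe_univ, Set.image_univ, b.convexHull_eq_nonneg_coord]
          exact hbx
      · push Not at hxg
        obtain ⟨p, hp, q, hq, hx⟩ := hxg
        exact Or.inl (Set.mem_iUnion₂.2 ⟨p, hp, Set.mem_iUnion₂.2 ⟨q, hq, hx⟩⟩)
    have hnull : volume (⋃ p ∈ P, ⋃ q ∈ P, (affineSpan ℝ ({p, q} : Set Plane) : Set Plane)) = 0 := by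
      refine (measure_biUnion_null_iff P.countable_toSet).2 fun p _ =>
        (measure_biUnion_null_iff P.countable_toSet).2 fun q _ => volume_affineSpan_pair p q
    have harea : ∀ t ∈ T, volume (convexHull ℝ (t : Set Plane)) ≤
        ENNReal.ofReal (3 * √3 / 4 * R ^ 2) := by
      intro t ht
      obtain ⟨b, -, hbt, c, hc⟩ := (Finset.mem_filter.1 ht).2
      rw [hbt]
      exact volume_triangle_le_of_mem_closedBall c b hc
    calc volume (Metric.closedBall (0 : Plane) (ρ - 3 * r))
        ≤ 0 + ∑ t ∈ T, volume (convexHull ℝ (t : Set Plane)) := by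
          refine (measure_mono hcover).trans ((measure_union_le _ _).trans ?_)
          rw [hnull]
          gcongr
          exact measure_biUnion_finset_le _ _
      _ ≤ T.card • ENNReal.ofReal (3 * √3 / 4 * R ^ 2) := by
          rw [zero_add]
          exact Finset.sum_le_card_nsmul _ _ _ harea
      _ = ENNReal.ofReal (T.card * (3 * √3 / 4 * R ^ 2)) := by
          rw [nsmul_eq_mul, ENNReal.ofReal_mul (Nat.cast_nonneg _), ENNReal.ofReal_natCast]
      _ ≤ _ := by
          apply ENNReal.ofReal_le_ofReal
          have : (T.card : ℝ) ≤ 2 * P.card := by exact_mod_cast hcard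
          rw [hR, Real.sq_sqrt (by positivity)]
          calc (T.card : ℝ) * (3 * √3 / 4 * (r ^ 2 + 2 * δ))
              ≤ 2 * P.card * (3 * √3 / 4 * (r ^ 2 + 2 * δ)) := by gcongr
            _ = _ := by ring
  have hlim : Tendsto (fun δ : ℝ => ENNReal.ofReal (P.card * (3 * √3 / 2 * (r ^ 2 + 2 * δ))))
      (nhdsWithin 0 (Set.Ioi 0)) (nhds (ENNReal.ofReal (P.card * (3 * √3 / 2 * r ^ 2)))) := by
    apply tendsto_nhdsWithin_of_tendsto_nhds
    have : Continuous fun δ : ℝ => ENNReal.ofReal (P.card * (3 * √3 / 2 * (r ^ 2 + 2 * δ))) :=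
      ENNReal.continuous_ofReal.comp (by fun_prop)
    simpa using this.tendsto 0
  rw [← ENNReal.ofReal_natCast, ← ENNReal.ofReal_mul (by positivity)]
  refine ge_of_tendsto hlim ?_
  filter_upwards [Ioc_mem_nhdsGT (show (0 : ℝ) < r ^ 2 by positivity)] with δ hδ
  exact key δ hδ.1 hδ.2

/-! ### The regular hexagon -/

/-- The unit vector of direction `φ`. -/
noncomputable def unitVec (φ : ℝ) : Plane := !₂[Real.cos φ, Real.sin φ]

lemma unitVec_add_pi (φ : ℝ) : unitVec (φ + Real.pi) = -unitVec φ := by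
  ext i
  fin_cases i <;> simp [unitVec]

lemma unitVec_add_pi_div_three (φ : ℝ) :
    unitVec (φ + Real.pi / 3) = unitVec φ + unitVec (φ + 2 * (Real.pi / 3)) := by
  have h1 : Real.cos (2 * (Real.pi / 3)) = -(1 / 2) := by
    rw [Real.cos_two_mul, Real.cos_pi_div_three]
    norm_num
  have h2 : Real.sin (2 * (Real.pi / 3)) = √3 / 2 := by
    rw [Real.sin_two_mul, Real.cos_pi_div_three, Real.sin_pi_div_three]
    ring
  ext i
  fin_cases i
  · simp [unitVec, Real.cos_add, h1, h2]
    ring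
  · simp [unitVec, Real.sin_add, h1, h2]
    ring

lemma cross_unitVec (φ : ℝ) : cross (unitVec φ) (unitVec (φ + 2 * (Real.pi / 3))) = √3 / 2 := by
  have h2 : Real.sin (2 * (Real.pi / 3)) = √3 / 2 := by
    rw [Real.sin_two_mul, Real.cos_pi_div_three, Real.sin_pi_div_three]
    ring
  rw [← h2, show 2 * (Real.pi / 3) = (φ + 2 * (Real.pi / 3)) - φ by ring, Real.sin_sub]
  simp [cross, unitVec]
  ring

/-- The standard hexagon in lattice coordinates. -/
def standardHexagon : Set (ℝ × ℝ) := {z | |z.1| ≤ 1 ∧ |z.2| ≤ 1 ∧ |z.1 - z.2| ≤ 1}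

lemma convex_standardHexagon : Convex ℝ standardHexagon := by
  rintro z ⟨h1, h2, h3⟩ w ⟨h4, h5, h6⟩ α β hα hβ hαβ
  rw [abs_le] at h1 h2 h3 h4 h5 h6
  obtain rfl : β = 1 - α := by linarith
  refine ⟨abs_le.2 ⟨?_, ?_⟩, abs_le.2 ⟨?_, ?_⟩, abs_le.2 ⟨?_, ?_⟩⟩ <;>
    simp only [Prod.fst_add, Prod.smul_fst, Prod.snd_add, Prod.smul_snd, smul_eq_mul] <;>
    nlinarith

lemma add_smul_add_smul_mem {H : Set Plane} (hH : Convex ℝ H) {c p q : Plane} (hc : c ∈ H)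
    (hp : c + p ∈ H) (hq : c + q ∈ H) {s t : ℝ} (hs : 0 ≤ s) (ht : 0 ≤ t) (hst : s + t ≤ 1) :
    c + (s • p + t • q) ∈ H := by
  have h := hH.sum_mem (t := Finset.univ) (w := ![1 - s - t, s, t]) (z := ![c, c + p, c + q])
    (by intro i _; fin_cases i <;> simp <;> linarith)
    (by simp only [Fin.sum_univ_three, Matrix.cons_val]; ring)
    (by intro i _; fin_cases i <;> simp [hc, hp, hq])
  convert h using 1
  simp only [Fin.sum_univ_three, Matrix.cons_val]
  module

/-- The vertex between those of `a` and `b` is `a + b`, so relative to the centre the six vertices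
are `±a`, `±b`, `±(a + b)`. Conversely, the coordinate region splits into six triangles, each
spanned by the centre and two adjacent vertices. -/
lemma regularHexagon_eq (c : Plane) (r θ : ℝ) :
    regularHexagon c r θ = (fun z : ℝ × ℝ => c + (z.1 • (r • unitVec θ) +
      z.2 • (r • unitVec (θ + 2 * (Real.pi / 3))))) '' standardHexagon := by
  set a := r • unitVec θ with ha
  set b := r • unitVec (θ + 2 * (Real.pi / 3)) with hb
  have e1 : r • unitVec (θ + Real.pi / 3) = a + b := by
    rw [unitVec_add_pi_div_three, smul_add]
  have v0 : r • unitVec (θ + (0 : ℕ) * (Real.pi / 3)) = a := by simp [ha]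
  have v1 : r • unitVec (θ + (1 : ℕ) * (Real.pi / 3)) = a + b := by
    rw [← e1, Nat.cast_one, one_mul]
  have v2 : r • unitVec (θ + (2 : ℕ) * (Real.pi / 3)) = b := by simp [hb]
  have v3 : r • unitVec (θ + (3 : ℕ) * (Real.pi / 3)) = -a := by
    rw [ha, ← smul_neg, ← unitVec_add_pi]
    congr 2
    push_cast
    ring
  have v4 : r • unitVec (θ + (4 : ℕ) * (Real.pi / 3)) = -(a + b) := by
    rw [← e1, ← smul_neg, ← unitVec_add_pi]
    congr 2
    push_cast
    ring
  have v5 : r • unitVec (θ + (5 : ℕ) * (Real.pi / 3)) = -b := by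
    rw [hb, ← smul_neg, ← unitVec_add_pi]
    congr 2
    push_cast
    ring
  have hdef : regularHexagon c r θ = convexHull ℝ (Set.range fun k : Fin 6 =>
      c + r • unitVec (θ + (k : ℕ) * (Real.pi / 3))) := rfl
  rw [hdef]
  apply Set.Subset.antisymm
  · refine convexHull_min ?_ (convex_image_affine _ _ _ convex_standardHexagon)
    rintro _ ⟨k, rfl⟩
    fin_cases k
    · exact ⟨(1, 0), by norm_num [standardHexagon], by simpa using v0.symm⟩
    · exact ⟨(1, 1), by norm_num [standardHexagon], by simpa using v1.symm⟩
    · exact ⟨(0, 1), by norm_num [standardHexagon], by simpa using v2.symm⟩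
    · exact ⟨(-1, 0), by norm_num [standardHexagon], by simpa using v3.symm⟩
    · have e4 : c + ((-1 : ℝ) • a + (-1 : ℝ) • b) = c + -(a + b) := by module
      exact ⟨(-1, -1), by norm_num [standardHexagon], e4.trans (congrArg (c + ·) v4.symm)⟩
    · exact ⟨(0, -1), by norm_num [standardHexagon], by simpa using v5.symm⟩
  · set H := convexHull ℝ (Set.range fun k : Fin 6 =>
      c + r • unitVec (θ + (k : ℕ) * (Real.pi / 3))) with hH
    have hconv : Convex ℝ H := convex_convexHull _ _
    have hk : ∀ k : Fin 6, c + r • unitVec (θ + (k : ℕ) * (Real.pi / 3)) ∈ H :=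
      fun k => subset_convexHull ℝ _ ⟨k, rfl⟩
    have m0 : c + a ∈ H := by rw [← v0]; exact hk 0
    have m1 : c + (a + b) ∈ H := by rw [← v1]; exact hk 1
    have m2 : c + b ∈ H := by rw [← v2]; exact hk 2
    have m3 : c + -a ∈ H := by rw [← v3]; exact hk 3
    have m4 : c + -(a + b) ∈ H := by rw [← v4]; exact hk 4
    have m5 : c + -b ∈ H := by rw [← v5]; exact hk 5
    have mc : c ∈ H := by
      convert hconv m0 m3 (show (0 : ℝ) ≤ 1 / 2 by norm_num) (show (0 : ℝ) ≤ 1 / 2 by norm_num)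
        (by norm_num) using 1
      module
    rintro _ ⟨⟨s, t⟩, ⟨h1, h2, h3⟩, rfl⟩
    simp only [abs_le] at h1 h2 h3 ⊢
    rcases le_total 0 s with hs | hs <;> rcases le_total 0 t with ht | ht
    · rcases le_total s t with hst | hst
      · convert add_smul_add_smul_mem hconv mc m1 m2 hs (sub_nonneg.2 hst) (by linarith) using 1
        module
      · convert add_smul_add_smul_mem hconv mc m0 m1 (sub_nonneg.2 hst) ht (by linarith) using 1
        module
    · convert add_smul_add_smul_mem hconv mc m0 m5 hs (neg_nonneg.2 ht) (by linarith) using 1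
      module
    · convert add_smul_add_smul_mem hconv mc m2 m3 ht (neg_nonneg.2 hs) (by linarith) using 1
      module
    · rcases le_total s t with hst | hst
      · convert add_smul_add_smul_mem hconv mc m4 m3 (neg_nonneg.2 ht) (sub_nonneg.2 hst)
          (by linarith) using 1
        module
      · convert add_smul_add_smul_mem hconv mc m4 m5 (neg_nonneg.2 hs) (sub_nonneg.2 hst)
          (by linarith) using 1
        module

lemma cross_hexagon (r θ : ℝ) :
    cross (r • unitVec θ) (r • unitVec (θ + 2 * (Real.pi / 3))) = √3 / 2 * r ^ 2 := by
  rw [← cross_unitVec θ]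
  simp only [cross, PiLp.smul_apply, smul_eq_mul]
  ring

lemma volume_regularHexagon (c : Plane) (r θ : ℝ) :
    volume (regularHexagon c r θ) = ENNReal.ofReal (3 * √3 / 2 * r ^ 2) := by
  rw [regularHexagon_eq, volume_image_affine, standardHexagon, volume_standard_hexagon,
    cross_hexagon, abs_of_nonneg (by positivity), show (3 : ENNReal) = ENNReal.ofReal 3 by norm_num,
    ← ENNReal.ofReal_mul (by positivity)]
  congr 1
  ring

/-- A disk is not contained in the hexagon inscribed in it. -/
lemma not_closedBall_subset_regularHexagon (c : Plane) {r : ℝ} (hr : 0 < r) (θ : ℝ) :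
    ¬ Metric.closedBall c r ⊆ regularHexagon c r θ := by
  intro h
  have := measure_mono (μ := volume) h
  rw [volume_regularHexagon, EuclideanSpace.volume_closedBall_fin_two,
    ← ENNReal.ofReal_pow hr.le, ← ENNReal.ofReal_mul (by positivity),
    ENNReal.ofReal_le_ofReal_iff (by positivity)] at this
  -- Area comparison: `3√3/2 < 3 < π`.
  have h3 : √3 < 2 := by
    rw [Real.sqrt_lt' (by norm_num)]
    norm_num
  nlinarith [Real.pi_gt_three, pow_pos hr 2]

/-! ### The hexagonal lattice -/

lemma linearIndependent_of_cross_ne_zero {a b : Plane} (h : cross a b ≠ 0) :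
    LinearIndependent ℝ ![a, b] := by
  rw [LinearIndependent.pair_iff]
  intro s t hst
  have h0 : s * a 0 + t * b 0 = 0 := by simpa using congrArg (fun x : Plane => x 0) hst
  have h1 : s * a 1 + t * b 1 = 0 := by simpa using congrArg (fun x : Plane => x 1) hst
  rw [cross] at h
  constructor
  · refine (mul_eq_zero.1 (?_ : s * (a 0 * b 1 - a 1 * b 0) = 0)).resolve_right h
    linear_combination b 1 * h0 - b 0 * h1
  · refine (mul_eq_zero.1 (?_ : t * (a 0 * b 1 - a 1 * b 0) = 0)).resolve_right h
    linear_combination a 0 * h1 - a 1 * h0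

/-- The basis formed by two independent plane vectors. -/
noncomputable def pairBasis {a b : Plane} (h : cross a b ≠ 0) : Module.Basis (Fin 2) ℝ Plane :=
  basisOfLinearIndependentOfCardEqFinrank (linearIndependent_of_cross_ne_zero h) (by simp)

lemma coe_pairBasis {a b : Plane} (h : cross a b ≠ 0) : ⇑(pairBasis h) = ![a, b] :=
  coe_basisOfLinearIndependentOfCardEqFinrank _ _

lemma exists_coords {a b : Plane} (h : cross a b ≠ 0) (x : Plane) :
    ∃ s t : ℝ, x = s • a + t • b := by
  refine ⟨(pairBasis h).repr x 0, (pairBasis h).repr x 1, ?_⟩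
  have := (pairBasis h).sum_repr x
  rw [Fin.sum_univ_two, coe_pairBasis] at this
  exact this.symm

lemma volume_fundamentalDomain_pairBasis {a b : Plane} (h : cross a b ≠ 0) :
    volume (ZSpan.fundamentalDomain (pairBasis h)) = ENNReal.ofReal |cross a b| := by
  have himage : ZSpan.fundamentalDomain (pairBasis h) =
      (fun z : ℝ × ℝ => 0 + (z.1 • a + z.2 • b)) '' (Set.Ico 0 1 ×ˢ Set.Ico 0 1) := by
    ext x
    rw [ZSpan.mem_fundamentalDomain]
    constructor
    · intro hx
      refine ⟨((pairBasis h).repr x 0, (pairBasis h).repr x 1), ⟨hx 0, hx 1⟩, ?_⟩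
      have := (pairBasis h).sum_repr x
      rw [Fin.sum_univ_two, coe_pairBasis] at this
      simpa using this
    · rintro ⟨⟨s, t⟩, ⟨hs, ht⟩, rfl⟩ i
      have ha : (pairBasis h).repr a = Finsupp.single 0 1 := by
        rw [← (pairBasis h).repr_self 0, coe_pairBasis]
        rfl
      have hb : (pairBasis h).repr b = Finsupp.single 1 1 := by
        rw [← (pairBasis h).repr_self 1, coe_pairBasis]
        rfl
      simp only [zero_add, map_add, map_smul, ha, hb]
      fin_cases i
      · simpa using hs
      · simpa using ht
  rw [himage, volume_image_affine, Measure.volume_eq_prod, Measure.prod_prod]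
  simp

/-- Integer translates of the standard hexagon by the vectors `(2, 1)` and `(1, 2)` cover the
plane. -/
lemma exists_int_mem_standardHexagon (s t : ℝ) :
    ∃ m n : ℤ, (s - (2 * m + n), t - (m + 2 * n)) ∈ standardHexagon := by
  -- The vectors `(2, 1)` and `(1, 2)` generate exactly the integer points whose coordinate sum is
  -- divisible by `3`.
  have key : ∀ x y k : ℤ, x + y = 3 * k → |s - x| ≤ 1 → |t - y| ≤ 1 → |(s - x) - (t - y)| ≤ 1 →
      ∃ m n : ℤ, (s - (2 * m + n), t - (m + 2 * n)) ∈ standardHexagon := by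
    intro x y k hk h1 h2 h3
    have hx : (2 * ((x - k : ℤ) : ℝ) + ((y - k : ℤ) : ℝ)) = x := by
      have : (x : ℝ) + y = 3 * k := by exact_mod_cast hk
      push_cast
      linarith
    have hy : (((x - k : ℤ) : ℝ) + 2 * ((y - k : ℤ) : ℝ)) = y := by
      have : (x : ℝ) + y = 3 * k := by exact_mod_cast hk
      push_cast
      linarith
    refine ⟨x - k, y - k, ?_⟩
    rw [hx, hy]
    exact ⟨h1, h2, h3⟩
  have f0 := Int.floor_le s
  have f1 := Int.lt_floor_add_one s
  have g0 := Int.floor_le t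
  have g1 := Int.lt_floor_add_one t
  -- The residue modulo `3` says how many coordinates to round up; if just one, it is the one with
  -- the larger fractional part.
  obtain ⟨k, hk⟩ : ∃ k : ℤ, ⌊s⌋ + ⌊t⌋ = 3 * k ∨ ⌊s⌋ + ⌊t⌋ + 1 = 3 * k ∨ ⌊s⌋ + ⌊t⌋ + 2 = 3 * k :=
    ⟨(⌊s⌋ + ⌊t⌋ + 2) / 3, by omega⟩
  rcases hk with hk | hk | hk
  · refine key ⌊s⌋ ⌊t⌋ k hk ?_ ?_ ?_ <;> rw [abs_le] <;> constructor <;> linarith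
  · rcases le_total (t - ⌊t⌋) (s - ⌊s⌋) with h | h
    · refine key (⌊s⌋ + 1) ⌊t⌋ k (by linarith) ?_ ?_ ?_ <;> rw [abs_le] <;> push_cast <;>
        constructor <;> linarith
    · refine key ⌊s⌋ (⌊t⌋ + 1) k (by linarith) ?_ ?_ ?_ <;> rw [abs_le] <;> push_cast <;>
        constructor <;> linarith
  · refine key (⌊s⌋ + 1) (⌊t⌋ + 1) k (by linarith) ?_ ?_ ?_ <;> rw [abs_le] <;> push_cast <;>
      constructor <;> linarith

/-- Some lattice whose fundamental domain has the area of the hexagon yields a covering by translates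
of the hexagon. -/
lemma exists_basis_covering (c : Plane) {r : ℝ} (hr : 0 < r) (θ : ℝ) :
    ∃ B : Module.Basis (Fin 2) ℝ Plane,
      volume (ZSpan.fundamentalDomain B) = ENNReal.ofReal (3 * √3 / 2 * r ^ 2) ∧
      IsCovering (latticeArrangement (Submodule.span ℤ (Set.range B)) (regularHexagon c r θ)) := by
  set a := r • unitVec θ with ha
  set b := r • unitVec (θ + 2 * (Real.pi / 3)) with hb
  have hab : cross a b = √3 / 2 * r ^ 2 := cross_hexagon r θ
  have hab0 : cross a b ≠ 0 := by
    rw [hab]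
    positivity
  -- The sublattice has index `3`, so its covolume is exactly the area of the hexagon.
  have hcross : cross ((2 : ℤ) • a + b) (a + (2 : ℤ) • b) = 3 * √3 / 2 * r ^ 2 := by
    have : cross ((2 : ℤ) • a + b) (a + (2 : ℤ) • b) = 3 * cross a b := by
      simp [cross]
      ring
    rw [this, hab]
    ring
  have h0 : cross ((2 : ℤ) • a + b) (a + (2 : ℤ) • b) ≠ 0 := by
    rw [hcross]
    positivity
  refine ⟨pairBasis h0, ?_, ?_⟩
  · rw [volume_fundamentalDomain_pairBasis, hcross, abs_of_nonneg (by positivity)]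
  · rw [IsCovering, Set.eq_univ_iff_forall]
    intro x
    obtain ⟨s, t, hst⟩ := exists_coords hab0 (x - c)
    obtain ⟨m, n, hmn⟩ := exists_int_mem_standardHexagon s t
    have hv : m • ((2 : ℤ) • a + b) + n • (a + (2 : ℤ) • b) ∈
        Submodule.span ℤ (Set.range (pairBasis h0)) := by
      rw [coe_pairBasis]
      exact add_mem (Submodule.smul_mem _ _ (Submodule.subset_span ⟨0, rfl⟩))
        (Submodule.smul_mem _ _ (Submodule.subset_span ⟨1, rfl⟩))
    refine Set.mem_iUnion.2 ⟨⟨_, hv⟩, ?_⟩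
    rw [latticeArrangement, regularHexagon_eq, Set.image_image]
    refine ⟨_, hmn, ?_⟩
    rw [← ha, ← hb, eq_add_of_sub_eq hst]
    module

/-! ### Densities -/

lemma IsTranslateOf.isCongruentTo {n : ℕ} {S K : Set (EuclideanSpace ℝ (Fin n))}
    (h : IsTranslateOf S K) : IsCongruentTo S K := by
  obtain ⟨v, rfl⟩ := h
  exact ⟨IsometryEquiv.addRight v, rfl⟩

lemma coveringDensity_le_translativeCoveringDensity {n : ℕ} (K : Set (EuclideanSpace ℝ (Fin n))) :
    coveringDensity K ≤ translativeCoveringDensity K := by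
  apply sInf_le_sInf
  rintro d ⟨ι, F, hF, hcov, hd⟩
  exact ⟨ι, F, fun i => (hF i).isCongruentTo, hcov, hd⟩

lemma translativeCoveringDensity_le_latticeCoveringDensity {n : ℕ}
    (K : Set (EuclideanSpace ℝ (Fin n))) :
    translativeCoveringDensity K ≤ latticeCoveringDensity K := by
  apply sInf_le_sInf
  rintro d ⟨L, _, -, hcov, hd⟩
  exact ⟨L, latticeArrangement L K, fun v => ⟨v, rfl⟩, hcov, hd⟩

/-- Isometries preserve area. -/
lemma volume_image_isometryEquiv {n : ℕ}
    (φ : EuclideanSpace ℝ (Fin n) ≃ᵢ EuclideanSpace ℝ (Fin n)) (K : Set (EuclideanSpace ℝ (Fin n))) :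
    volume (φ '' K) = volume K := by
  -- Mazur–Ulam: `φ` is a linear isometry followed by a translation.
  set L := φ.toRealLinearIsometryEquiv with hL
  have h : φ '' K = (fun y => φ 0 + y) '' (L.symm ⁻¹' K) := by
    rw [show L.symm ⁻¹' K = L '' K from (L.toEquiv.image_eq_preimage_symm K).symm, Set.image_image]
    refine Set.image_congr fun x _ => ?_
    rw [hL, IsometryEquiv.toRealLinearIsometryEquiv_apply, add_sub_cancel]
  rw [h, Set.image_add_left, measure_preimage_add,
    L.symm.measurePreserving.measure_preimage_emb L.symm.toHomeomorph.measurableEmbedding]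

/-- Changing the radius by a constant does not affect densities, which absorbs the boundary losses
in both bounds. -/
lemma tendsto_volume_closedBall_div (D : ℝ) :
    Tendsto (fun R : ℝ => volume (Metric.closedBall (0 : Plane) (R + D)) /
      volume (Metric.closedBall (0 : Plane) R)) atTop (nhds 1) := by
  have h1 : Tendsto (fun R : ℝ => ENNReal.ofReal ((1 + D / R) ^ 2)) atTop (nhds 1) := by
    have h2 : Tendsto (fun R : ℝ => (1 + D / R) ^ 2) atTop (nhds ((1 + 0) ^ 2)) :=
      (tendsto_const_nhds.add (tendsto_const_nhds.div_atTop tendsto_id)).pow 2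
    simpa using ENNReal.tendsto_ofReal h2
  refine h1.congr' ?_
  filter_upwards [eventually_gt_atTop 0, eventually_ge_atTop (-D)] with R hR hRD
  rw [EuclideanSpace.volume_closedBall_fin_two, EuclideanSpace.volume_closedBall_fin_two,
    ← ENNReal.ofReal_pow hR.le, ← ENNReal.ofReal_pow (by linarith),
    ← ENNReal.ofReal_mul (by positivity), ← ENNReal.ofReal_mul (by positivity),
    ← ENNReal.ofReal_div_of_pos (by positivity)]
  congr 1
  field_simp

lemma tendsto_const_mul_volume_closedBall_div {κ : ENNReal} (hκ : κ ≠ ⊤) (D : ℝ) :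
    Tendsto (fun R : ℝ => κ * volume (Metric.closedBall (0 : Plane) (R + D)) /
      volume (Metric.closedBall (0 : Plane) R)) atTop (nhds κ) := by
  have := ENNReal.Tendsto.const_mul (a := κ) (tendsto_volume_closedBall_div D) (Or.inr hκ)
  rw [mul_one] at this
  refine this.congr fun R => ?_
  rw [mul_div_assoc]

open scoped Pointwise in
/-- A lattice arrangement of a bounded set has density at most area over covolume. -/
lemma coveringFamilyDensity_latticeArrangement_le (B : Module.Basis (Fin 2) ℝ Plane) {K : Set Plane}
    (hK : Bornology.IsBounded K) :
    coveringFamilyDensity (latticeArrangement (Submodule.span ℤ (Set.range B)) K) ≤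
      volume K / volume (ZSpan.fundamentalDomain B) := by
  set L := Submodule.span ℤ (Set.range B)
  set Q := ZSpan.fundamentalDomain B with hQ
  have hQ0 : volume Q ≠ 0 := ZSpan.measure_fundamentalDomain_ne_zero B
  have hQt : volume Q ≠ ⊤ := (ZSpan.fundamentalDomain_isBounded B).measure_lt_top.ne
  have hKt : volume K ≠ ⊤ := hK.measure_lt_top.ne
  obtain ⟨D₁, hD₁⟩ := hK.exists_norm_le
  obtain ⟨D₂, hD₂⟩ := (ZSpan.fundamentalDomain_isBounded B).exists_norm_le
  have : VAddInvariantMeasure L Plane volume :=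
    ⟨fun v s _ => measure_preimage_add volume (v : Plane) s⟩
  -- Each translate meeting the ball is charged to its own lattice cell; these cells are disjoint
  -- and lie in the enlarged ball.
  have key : ∀ R : ℝ, volumeIn (latticeArrangement L K) (Metric.closedBall 0 R) ≤
      volume K / volume Q * volume (Metric.closedBall (0 : Plane) (R + (D₁ + D₂))) := by
    intro R
    rw [(ZSpan.isAddFundamentalDomain B volume).measure_eq_tsum'
      (Metric.closedBall (0 : Plane) (R + (D₁ + D₂))), ← ENNReal.tsum_mul_left]
    refine ENNReal.tsum_le_tsum fun v => ?_
    rcases (latticeArrangement L K v ∩ Metric.closedBall 0 R).eq_empty_or_nonempty with h | h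
    · rw [h, measure_empty]
      exact zero_le
    · obtain ⟨_, ⟨k, hk, rfl⟩, hR⟩ := h
      have hv : ‖(v : Plane)‖ ≤ R + D₁ := by
        rw [mem_closedBall_zero_iff] at hR
        have := norm_sub_le (k + (v : Plane)) k
        rw [add_sub_cancel_left] at this
        linarith [hD₁ k hk]
      have hsub : v +ᵥ Q ⊆ Metric.closedBall (0 : Plane) (R + (D₁ + D₂)) := by
        rintro _ ⟨x, hx, rfl⟩
        rw [mem_closedBall_zero_iff]
        have := norm_add_le (v : Plane) x
        change ‖(v : Plane) + x‖ ≤ _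
        linarith [hD₂ x hx]
      rw [Set.inter_eq_right.2 hsub, measure_vadd, ENNReal.div_mul_cancel hQ0 hQt]
      refine (measure_mono Set.inter_subset_left).trans (le_of_eq ?_)
      exact volume_image_isometryEquiv (IsometryEquiv.addRight (v : Plane)) K
  rw [coveringFamilyDensity, ← (tendsto_const_mul_volume_closedBall_div
    (ENNReal.div_ne_top hKt hQ0) (D₁ + D₂)).liminf_eq]
  exact liminf_le_liminf (Eventually.of_forall fun R => ENNReal.div_le_div_right (key R) _)

/-- A covering by congruent copies of a set contained in a disk of radius `r` has density at least
the area of the set divided by the area of the hexagon inscribed in the disk. -/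
lemma le_coveringFamilyDensity {K : Set Plane} {c : Plane} {r : ℝ} (hr : 0 < r)
    (hK0 : volume K ≠ 0) (hKc : K ⊆ Metric.closedBall c r) {ι : Type} {F : ι → Set Plane}
    (hF : ∀ i, IsCongruentTo (F i) K) (hcov : IsCovering F) :
    volume K / ENNReal.ofReal (3 * √3 / 2 * r ^ 2) ≤ coveringFamilyDensity F := by
  classical
  set A := ENNReal.ofReal (3 * √3 / 2 * r ^ 2) with hA
  have hA0 : A ≠ 0 := by
    rw [hA, Ne, ENNReal.ofReal_eq_zero, not_le]
    positivity
  have hKt : volume K ≠ ⊤ :=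
    ((measure_mono hKc).trans_lt (isCompact_closedBall c r).measure_lt_top).ne
  choose φ hφ using hF
  have hvol : ∀ i, volume (F i) = volume K := fun i => by
    rw [hφ i, volume_image_isometryEquiv]
  have hball : ∀ i, F i ⊆ Metric.closedBall (φ i c) r := by
    intro i
    rw [hφ i]
    rintro _ ⟨x, hx, rfl⟩
    rw [Metric.mem_closedBall, (φ i).dist_eq]
    exact hKc hx
  -- The loss `5r` is made of `r` to keep the disks inside the ball, `r` so that their centres serve
  -- every point of the covered ball, and `3r` from Kershner's theorem.
  have key : ∀ R : ℝ, volume K / A * volume (Metric.closedBall (0 : Plane) (R + -(5 * r))) ≤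
      volumeIn F (Metric.closedBall 0 R) := by
    intro R
    let I : Set ι := {i | φ i c ∈ Metric.closedBall (0 : Plane) (R - r)}
    have hlow : ∑' _ : I, volume K ≤ volumeIn F (Metric.closedBall 0 R) := by
      refine le_trans (ENNReal.tsum_le_tsum fun i : I => ?_)
        (ENNReal.tsum_comp_le_tsum_of_injective Subtype.val_injective _)
      rw [← hvol i, Set.inter_eq_left.2]
      refine (hball i).trans (Metric.closedBall_subset_closedBall' ?_)
      have := i.2
      simp only [I, Set.mem_ofPred_eq, Metric.mem_closedBall] at this
      linarith
    refine le_trans ?_ hlow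
    rcases I.finite_or_infinite with hI | hI
    · have hcover : ∀ y ∈ Metric.closedBall (0 : Plane) (R - 2 * r),
          ∃ p ∈ hI.toFinset.image fun i => φ i c, dist p y ≤ r := by
        intro y hy
        obtain ⟨i, hi⟩ := Set.mem_iUnion.1 (hcov.symm ▸ Set.mem_univ y : y ∈ ⋃ i, F i)
        have hiy : dist (φ i c) y ≤ r := by
          rw [dist_comm]
          exact hball i hi
        refine ⟨φ i c, Finset.mem_image.2 ⟨i, hI.mem_toFinset.2 ?_, rfl⟩, hiy⟩
        have h1 := dist_triangle (φ i c) y 0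
        rw [Metric.mem_closedBall] at hy
        simp only [I, Set.mem_ofPred_eq, Metric.mem_closedBall]
        linarith
      have h2 := volume_closedBall_le_card_mul hr hcover
      rw [show R - 2 * r - 3 * r = R + -(5 * r) by ring] at h2
      -- Different members may share a centre, which only lowers the number of points.
      have h3 : (((hI.toFinset.image fun i => φ i c).card : ℕ) : ENNReal) ≤ hI.toFinset.card := by
        exact_mod_cast Finset.card_image_le
      have h4 : ∑' _ : I, volume K = hI.toFinset.card * volume K := by
        have := hI.fintype
        rw [tsum_fintype, Finset.sum_const, nsmul_eq_mul, Finset.card_univ, ← Set.toFinset_card]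
        congr 3
        ext i
        simp
      calc volume K / A * volume (Metric.closedBall (0 : Plane) (R + -(5 * r)))
          ≤ volume K / A * (hI.toFinset.card * A) := by
            gcongr
            exact h2.trans (by gcongr)
        _ = hI.toFinset.card * (volume K / A * A) := by ring
        _ = _ := by rw [h4, ENNReal.div_mul_cancel hA0 ENNReal.ofReal_ne_top]
    -- Infinitely many copies of equal positive area lie in the ball, so their total area is
    -- infinite.
    · have := hI.to_subtype
      rw [ENNReal.tsum_const_eq_top_of_ne_zero hK0]
      exact le_top
  rw [coveringFamilyDensity, ← (tendsto_const_mul_volume_closedBall_div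
    (ENNReal.div_ne_top hKt hA0) (-(5 * r))).liminf_eq]
  exact liminf_le_liminf (Eventually.of_forall fun R => ENNReal.div_le_div_right (key R) _)

lemma IsCovering.mono {n : ℕ} {L : Submodule ℤ (EuclideanSpace ℝ (Fin n))}
    {H K : Set (EuclideanSpace ℝ (Fin n))} (h : IsCovering (latticeArrangement L H)) (hHK : H ⊆ K) :
    IsCovering (latticeArrangement L K) :=
  Set.univ_subset_iff.1 (h.symm.subset.trans (Set.iUnion_mono fun _ => Set.image_mono hHK))

end CoveringDensity

theorem proposition5 (K : Set (EuclideanSpace ℝ (Fin 2)))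
    (c : EuclideanSpace ℝ (Fin 2)) (r θ : ℝ) (hr : 0 < r)
    (hK : CoveringDensity.IsConvexDisk K)
    (hsand : CoveringDensity.IsSandwiched K (Metric.closedBall c r)
      (CoveringDensity.regularHexagon c r θ)) :
    CoveringDensity.coveringDensity K =
        volume K / volume (CoveringDensity.regularHexagon c r θ) ∧
      CoveringDensity.coveringDensity K = CoveringDensity.translativeCoveringDensity K ∧
      CoveringDensity.translativeCoveringDensity K =
        CoveringDensity.latticeCoveringDensity K := by
  open CoveringDensity in
  have hsub : regularHexagon c r θ ⊆ K ∧ K ⊆ Metric.closedBall c r := by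
    rcases hsand with ⟨h1, h2⟩ | h
    · exact absurd (h1.trans h2) (not_closedBall_subset_regularHexagon c hr θ)
    · exact h
  open CoveringDensity in
  have hK0 : volume K ≠ 0 := by
    have := isOpen_interior.measure_pos volume hK.nonempty_interior
    exact (this.trans_le (measure_mono interior_subset)).ne'
  open CoveringDensity in
  have hlower : volume K / volume (regularHexagon c r θ) ≤ coveringDensity K := by
    refine le_sInf ?_
    rintro _ ⟨ι, F, hF, hcov, rfl⟩
    rw [volume_regularHexagon]
    exact le_coveringFamilyDensity hr hK0 hsub.2 hF hcov
  open CoveringDensity in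
  have hupper : latticeCoveringDensity K ≤ volume K / volume (regularHexagon c r θ) := by
    obtain ⟨B, hB, hcov⟩ := exists_basis_covering c hr θ
    rw [volume_regularHexagon, ← hB]
    have hle : latticeCoveringDensity K ≤
        coveringFamilyDensity (latticeArrangement (Submodule.span ℤ (Set.range B)) K) :=
      sInf_le ⟨_, inferInstance, inferInstance, hcov.mono hsub.1, rfl⟩
    exact hle.trans (coveringFamilyDensity_latticeArrangement_le B hK.isCompact.isBounded)
  have h1 := CoveringDensity.coveringDensity_le_translativeCoveringDensity K
  have h2 := CoveringDensity.translativeCoveringDensity_le_latticeCoveringDensity K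
  exact ⟨le_antisymm (h1.trans (h2.trans hupper)) hlower,
    le_antisymm h1 ((h2.trans hupper).trans hlower),
    le_antisymm h2 ((hupper.trans hlower).trans h1)⟩
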